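/- Let $P\ge 1$ and $K\ge 0$ be integers, let $\varphi$ be a probability distribution on $\{0,1,\dots,K\}$ with $\varphi(k)>0$ for all $k$, put $\mathbb E_\varphi[\kappa]=\sum_{k=0}^K k\,\varphi(k)$, and let $V$ be a discrete memoryless channel with input alphabet $\{1,\dots,P\}$ and an output alphabet not containing $0$. All logarithms are to base $2$. **The noisy queue.** The input is a sequence ${\bf x}=(x_1,\dots,x_n)\in\{0,1,\dots,P\}^n$, where $x_i=0$ means that slot $i$ is empty and $x_i=p\neq 0$ that a packet of type $p$ is sent in slot $i$. Let $i_1<\dots<i_m$ be the slots with $x_i\ne 0$. The packets are served in order of arrival, with independent processing times $\kappa_1,\dots,\kappa_m$ distributed according to $\varphi$: with $j_0=0$, the $l$-th packet leaves in slot $j_l=\max\{i_l,\,j_{l-1}+1\}+\kappa_l$. Independently of this, the packet types pass through $V$. The output is the sequence of length $\max\{n,j_m\}$ (of length $n$ if $m=0$) which in slot $j_l$ has the output of $V$ for the input $x_{i_l}$, and $0$ in all other slots. **Zero-error capacity.** A zero-error code of length $n$ for a channel is a nonempty set $\mathcal C$ of inputs of length $n$ such that no two different elements of $\mathcal C$ can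 both produce, with positive probability, the same output. Its rate is $\frac{1}{L_{\rm av}}\log|\mathcal C|$, where $L_{\rm av}$ is the expected length of the output when the input is uniformly distributed on $\mathcal C$ (so $L_{\rm av}=n$ for a discrete memoryless channel). The zero-error capacity of the channel is the $\limsup$, as $n\to\infty$, of the largest rate of a zero-error code of length $n$. **Theorem.** If $V$ has zero-error capacity $\mathsf C_0$, then the zero-error capacity of the noisy queue with parameters $P$, $K$, $\varphi$, $V$ equals $$\max\left\{\frac{\log\left(2^{\mathsf C_0}+1\right)}{K+1},\ \frac{\mathsf C_0}{\mathbb E_\varphi[\kappa]+1}\right\}.$$ -/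

import Mathlib

noncomputable section

namespace ZeroError

/-- A channel that takes finite sequences over `A` to random finite sequences over `B`; the output
may be longer than the input. `Q x z` is the probability of the output `z` when `x` is sent. -/
abbrev Channel (A B : Type*) := List A → PMF (List B)

variable {A B : Type*}

/-- A zero-error code of length `n`: a nonempty finite set of inputs of length `n`, no two different
members of which can produce the same output. -/
def IsZeroErrorCode (Q : Channel A B) (n : ℕ) (C : Finset (List A)) : Prop :=
  C.Nonempty ∧ (∀ x ∈ C, x.length = n) ∧
    ∀ x ∈ C, ∀ y ∈ C, x ≠ y → ∀ z, ¬ (0 < Q x z ∧ 0 < Q y z)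

/-- The average output length `L_av`: the mean over the codewords (all equally likely) and over the
channel statistics. -/
def averageLength (Q : Channel A B) (C : Finset (List A)) : ℝ :=
  (1 / (C.card : ℝ)) * ∑ x ∈ C, ∑' z : List B, (z.length : ℝ) * (Q x z).toReal

/-- The rate of a code, in bits per output slot. -/
def codeRate (Q : Channel A B) (C : Finset (List A)) : ℝ :=
  (1 / averageLength Q C) * Real.logb 2 (C.card : ℝ)

/-- The zero-error capacity: the upper limit, as `n → ∞`, of the best rate of a zero-error code of
length `n`. It is taken in `EReal`, so that no boundedness convention is involved. -/
def zeroErrorCapacity (Q : Channel A B) : EReal :=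
  Filter.limsup
    (fun n : ℕ => ⨆ (C : Finset (List A)) (_ : IsZeroErrorCode Q n C), ((codeRate Q C : ℝ) : EReal))
    Filter.atTop

/-- The discrete memoryless channel with transition probabilities `V a b`. -/
def memoryless (V : A → PMF B) : Channel A B
  | [] => PMF.pure []
  | a :: x => (V a).bind fun b => (memoryless V x).map fun z => b :: z

/-- The discrete memoryless channel `V` acting on the packets only: an empty slot `none` stays
empty, and a packet `some a` becomes a packet `some b` with probability `V a b`. -/
def packetNoise (V : A → PMF B) : Channel (Option A) (Option B) :=
  memoryless fun s => match s with
    | none => PMF.pure none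
    | some a => (V a).map some

/-- The queue, run from the state in which `t` input slots have been read and the last departure was
in slot `j` (`j = 0` if there was none). It returns the law of the output from slot `j + 1` on.

The packet read in slot `i = t + 1` starts being processed in slot `max i (j + 1)`, is processed for
`k` slots with probability `φ k`, and departs in slot `j' = max i (j + 1) + k`; slots strictly between
two departures are empty. When the input, of length `t = n`, is exhausted, the output is filled up
with empty slots to length `n`, if it is not that long already. -/
def queueFrom {K : ℕ} (φ : PMF (Fin (K + 1))) : ℕ → ℕ → Channel (Option A) (Option A)
  | t, j, [] => PMF.pure (List.replicate (t - j) none)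
  | t, j, none :: x => queueFrom φ (t + 1) j x
  | t, j, some a :: x => φ.bind fun k =>
      let j' := max (t + 1) (j + 1) + (k : ℕ)
      (queueFrom φ (t + 1) j' x).map fun z => List.replicate (j' - (j + 1)) none ++ some a :: z

/-- The discrete-time FIFO queue with independent processing times of law `φ` on `{0, …, K}`;
`none` is an empty slot, and `some a` is a packet of type `a`. -/
def queue {K : ℕ} (φ : PMF (Fin (K + 1))) : Channel (Option A) (Option A) :=
  queueFrom φ 0 0

/-- The noisy queue: the packets pass through the queue and, independently of that, each of them
suffers the noise of the discrete memoryless channel `V`. -/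
def noisyQueue {K : ℕ} (φ : PMF (Fin (K + 1))) (V : A → PMF B) : Channel (Option A) (Option B) :=
  fun x => (queue φ x).bind (packetNoise V)

/-- The average processing time of a packet. -/
def meanProcessingTime {K : ℕ} (φ : PMF (Fin (K + 1))) : ℝ :=
  ∑ k : Fin (K + 1), (k : ℝ) * (φ k).toReal

end ZeroError

end

/-!
Write `q = 2 ^ C₀` and `E` for the mean processing time.

The memoryless channel enters through one relation on its letters, `Confusable`: two words can
produce the same output if and only if they have the same length and are confusable letter by
letter (`exists_memoryless_pos_iff`). Since powers of a code have its rate, a zero-error code of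
length `m` has at most `q ^ m` elements (`card_le_pow_of_zeroErrorCapacity_eq`), and for each `c <
C₀` there are codes of all lengths `m` with at least a constant times `2 ^ (c * m)` elements
(`exists_code_of_lt_zeroErrorCapacity`).

*Achievability.* If time is divided into blocks of `K + 1` slots and packets are sent in the first
slots of blocks only, then each packet departs within its block. So the set of nonempty blocks can
be chosen freely, and the types can be taken from a code for the memoryless channel of the
appropriate length; over `N` blocks this gives about `∑ m, N.choose m * q ^ m = (q + 1) ^ N`
codewords, and the output has length `N * (K + 1)` (`exists_blockCode`). If, on the other hand, a
packet is sent in every slot, the output for `n` packets has mean length `n * (E + 1)`, and the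
types still carry `q ^ n` codewords (`IsZeroErrorCode.map_some`).

*Converse.* Every service period can be prolonged so that the packet departs in a multiple of `K +
1`, because the `K + 1` possible departure slots are consecutive. Under these processing times the
timing of the output shows only the set `S` of the blocks at the ends of which packets depart, so
the codewords with the same `S` have types that form a code for the memoryless channel, and there
are at most `q ^ #S` of them (`IsZeroErrorCode.card_le_of_departureBlocks_eq`). Let `c` be the
last complete block not in `S` (`c = 0` if there is none), and `m` the number of elements of `S`
beyond `c`. These elements are consecutive (`filter_departureSet_eq_Ioc`), so `S` is determined by
`c`, `m` and an arbitrary subset of the blocks before `c`; hence at most `(q + 1) ^ c * q ^ m`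
codewords belong to `(c, m)` (`IsZeroErrorCode.card_filter_le`). On the other hand the queue is
empty at the end of block `c`, so that the `m` packets arrive after slot `c * (K + 1)`, and the
actual mean output length of such a codeword is at least `c * (K + 1) + m * (E + 1)`
(`le_meanLength_toReal`). If `R` is the claimed capacity, the number of these codewords is
therefore at most `2 ^ (R * L)` for the mean output length `L` of any one of them. Summing over
the polynomially many pairs `(c, m)` gives a Kraft inequality with a polynomial factor
(`IsZeroErrorCode.sum_rpow_neg_le`), and Jensen's inequality turns it into `log #C ≤ R * L_av +
O(log n)`; as `L_av ≥ n`, the rate is at most `R + o(1)`.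
-/

noncomputable section

namespace ZeroError

open scoped ENNReal

variable {A B : Type*}

/-! ### Confusability -/

/-- Two letters are confusable for `V` if some output letter is possible for both of them. -/
def Confusable (V : A → PMF B) (a a' : A) : Prop := ∃ b, 0 < V a b ∧ 0 < V a' b

/-- The letter channel through which `packetNoise V` sends each slot. -/
def slotNoise (V : A → PMF B) : Option A → PMF (Option B)
  | none => PMF.pure none
  | some a => (V a).map some

lemma pmf_pos_iff {α : Type*} (p : PMF α) (a : α) : 0 < p a ↔ a ∈ p.support := by
  rw [PMF.mem_support_iff, pos_iff_ne_zero]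

lemma packetNoise_eq_memoryless (V : A → PMF B) :
    packetNoise V = memoryless (slotNoise V) := by
  unfold packetNoise
  congr 1

lemma pure_pos_iff {α : Type*} (a b : α) : 0 < PMF.pure a b ↔ b = a := by
  rw [pmf_pos_iff, PMF.mem_support_pure_iff]

lemma bind_pos_iff {α β : Type*} (p : PMF α) (f : α → PMF β) (b : β) :
    0 < p.bind f b ↔ ∃ a, 0 < p a ∧ 0 < f a b := by
  simp only [pmf_pos_iff, PMF.mem_support_bind_iff]

lemma map_pos_iff {α β : Type*} (p : PMF α) (f : α → β) (b : β) :
    0 < p.map f b ↔ ∃ a, 0 < p a ∧ f a = b := by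
  simp only [pmf_pos_iff, PMF.mem_support_map_iff]

lemma memoryless_pos_iff (V : A → PMF B) (x : List A) (z : List B) :
    0 < memoryless V x z ↔ List.Forall₂ (fun a b => 0 < V a b) x z := by
  induction x generalizing z with
  | nil => rw [memoryless, pure_pos_iff, List.forall₂_nil_left_iff]
  | cons a x ih =>
    rw [memoryless, bind_pos_iff, List.forall₂_cons_left_iff]
    simp only [map_pos_iff, ih]
    constructor
    · rintro ⟨b, hb, w, hw, rfl⟩
      exact ⟨b, w, hb, hw, rfl⟩
    · rintro ⟨b, w, hb, hw, rfl⟩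
      exact ⟨b, hb, w, hw, rfl⟩

lemma exists_forall₂_and_forall₂_iff {α β : Type*} {R : α → β → Prop} (x y : List α) :
    (∃ z, List.Forall₂ R x z ∧ List.Forall₂ R y z) ↔
      List.Forall₂ (fun a a' => ∃ b, R a b ∧ R a' b) x y := by
  constructor
  · rintro ⟨z, hx, hy⟩
    induction hx generalizing y with
    | nil => cases hy; exact .nil
    | cons h _ ih =>
      cases hy with
      | cons h' hy => exact .cons ⟨_, h, h'⟩ (ih _ hy)
  · intro h
    induction h with
    | nil => exact ⟨[], .nil, .nil⟩
    | cons h _ ih =>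
      obtain ⟨b, hb, hb'⟩ := h
      obtain ⟨z, hz, hz'⟩ := ih
      exact ⟨b :: z, .cons hb hz, .cons hb' hz'⟩

lemma exists_memoryless_pos_iff (V : A → PMF B) (x y : List A) :
    (∃ z, 0 < memoryless V x z ∧ 0 < memoryless V y z) ↔
      List.Forall₂ (Confusable V) x y := by
  simp only [memoryless_pos_iff]
  exact exists_forall₂_and_forall₂_iff x y

/-- Empty slots are confusable with empty slots only, and packets with packets of confusable type:
timing information passes through `packetNoise` unharmed. -/
lemma confusable_slotNoise (V : A → PMF B) :
    Confusable (slotNoise V) = Option.Rel (Confusable V) := by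
  funext s s'
  apply propext
  rcases s with _ | a <;> rcases s' with _ | a' <;>
    simp only [Confusable, slotNoise, pmf_pos_iff, PMF.mem_support_pure_iff,
      PMF.mem_support_map_iff]
  · exact ⟨fun _ => .none, fun _ => ⟨none, rfl, rfl⟩⟩
  · constructor
    · rintro ⟨_, rfl, b, _, h⟩; cases h
    · rintro ⟨⟩
  · constructor
    · rintro ⟨_, ⟨b, _, rfl⟩, h⟩; cases h
    · rintro ⟨⟩
  · constructor
    · rintro ⟨_, ⟨b, hb, rfl⟩, b', hb', h⟩
      cases h
      exact .some ⟨b, by rwa [pmf_pos_iff], by rwa [pmf_pos_iff]⟩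
    · rintro ⟨b, hb, hb'⟩
      rw [pmf_pos_iff] at hb hb'
      exact ⟨some b, ⟨b, hb, rfl⟩, b, hb', rfl⟩

/-- Two inputs of the noisy queue share an output if and only if they have outputs of the bare queue
with the same timing and confusable types. -/
lemma exists_noisyQueue_pos_iff {K : ℕ} (φ : PMF (Fin (K + 1))) (V : A → PMF B)
    (x y : List (Option A)) :
    (∃ w, 0 < noisyQueue φ V x w ∧ 0 < noisyQueue φ V y w) ↔
      ∃ z z', 0 < queue φ x z ∧ 0 < queue φ y z' ∧
        List.Forall₂ (Option.Rel (Confusable V)) z z' := by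
  simp only [← confusable_slotNoise, ← exists_memoryless_pos_iff, ← packetNoise_eq_memoryless]
  simp only [noisyQueue, pmf_pos_iff, PMF.mem_support_bind_iff]
  constructor
  · rintro ⟨w, ⟨z, hz, hw⟩, z', hz', hw'⟩
    exact ⟨z, z', hz, hz', w, hw, hw'⟩
  · rintro ⟨z, z', hz, hz', w, hw, hw'⟩
    exact ⟨w, ⟨z, hz, hw⟩, z', hz', hw'⟩

lemma isZeroErrorCode_memoryless_iff (V : A → PMF B) (n : ℕ) (C : Finset (List A)) :
    IsZeroErrorCode (memoryless V) n C ↔ C.Nonempty ∧ (∀ x ∈ C, x.length = n) ∧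
      ∀ x ∈ C, ∀ y ∈ C, List.Forall₂ (Confusable V) x y → x = y := by
  simp only [IsZeroErrorCode, ← exists_memoryless_pos_iff, not_and, forall_exists_index, and_imp]
  refine and_congr_right fun _ => and_congr_right fun _ => ?_
  refine forall₂_congr fun x _ => forall₂_congr fun y _ => ?_
  refine ⟨fun h z hz hz' => by_contra fun hne => h hne z hz hz', fun h hne z hz hz' =>
    hne (h z hz hz')⟩

lemma forall₂_reduceOption {α β : Type*} {R : α → β → Prop} {z : List (Option α)}
    {z' : List (Option β)} (h : List.Forall₂ (Option.Rel R) z z') :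
    List.Forall₂ R z.reduceOption z'.reduceOption := by
  induction h with
  | nil => exact .nil
  | cons h _ ih =>
    cases h with
    | none => simpa using ih
    | some h => simpa using ⟨h, ih⟩

/-! ### Mean values and output lengths -/

/-- The mean of a `[0, ∞]`-valued function under a probability mass function. -/
def expect {α : Type*} (p : PMF α) (f : α → ℝ≥0∞) : ℝ≥0∞ := ∑' a, p a * f a

section expect

variable {α β : Type*}

lemma expect_pure (a : α) (f : α → ℝ≥0∞) : expect (PMF.pure a) f = f a := by
  rw [expect, tsum_eq_single a (by simp +contextual [PMF.pure_apply])]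
  simp

lemma expect_bind (p : PMF α) (g : α → PMF β) (f : β → ℝ≥0∞) :
    expect (p.bind g) f = expect p fun a => expect (g a) f := by
  simp only [expect, PMF.bind_apply, ← ENNReal.tsum_mul_left, ← ENNReal.tsum_mul_right]
  rw [ENNReal.tsum_comm]
  simp only [mul_assoc]

lemma expect_map (p : PMF α) (g : α → β) (f : β → ℝ≥0∞) :
    expect (p.map g) f = expect p fun a => f (g a) := by
  rw [← PMF.bind_pure_comp, expect_bind]
  simp only [Function.comp, expect_pure]

lemma expect_const (p : PMF α) (c : ℝ≥0∞) : expect p (fun _ => c) = c := by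
  rw [expect, ENNReal.tsum_mul_right, p.tsum_coe, one_mul]

lemma expect_mono {p : PMF α} {f g : α → ℝ≥0∞} (h : ∀ a, 0 < p a → f a ≤ g a) :
    expect p f ≤ expect p g := by
  refine ENNReal.tsum_le_tsum fun a => ?_
  rcases eq_or_ne (p a) 0 with h0 | h0
  · simp [h0]
  · gcongr
    exact h a (pos_iff_ne_zero.2 h0)

lemma expect_congr {p : PMF α} {f g : α → ℝ≥0∞} (h : ∀ a, 0 < p a → f a = g a) :
    expect p f = expect p g :=
  le_antisymm (expect_mono fun a ha => (h a ha).le) (expect_mono fun a ha => (h a ha).ge)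

lemma expect_add (p : PMF α) (f g : α → ℝ≥0∞) :
    expect p (fun a => f a + g a) = expect p f + expect p g := by
  simp only [expect, mul_add, ENNReal.tsum_add]

lemma le_expect {p : PMF α} {c : ℝ≥0∞} {f : α → ℝ≥0∞} (h : ∀ a, c ≤ f a) : c ≤ expect p f :=
  (expect_const p c).ge.trans (expect_mono fun a _ => h a)

end expect

/-- The mean output length for one input. -/
def meanLength (Q : Channel A B) (x : List A) : ℝ≥0∞ := expect (Q x) fun z => (z.length : ℝ≥0∞)

lemma averageLength_eq (Q : Channel A B) (C : Finset (List A)) :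
    averageLength Q C = (1 / (C.card : ℝ)) * ∑ x ∈ C, (meanLength Q x).toReal := by
  unfold averageLength meanLength expect
  congr 1
  refine Finset.sum_congr rfl fun x _ => ?_
  rw [ENNReal.tsum_toReal_eq fun z =>
    ENNReal.mul_ne_top ((Q x).apply_ne_top z) (ENNReal.natCast_ne_top _)]
  refine tsum_congr fun z => ?_
  rw [ENNReal.toReal_mul, ENNReal.toReal_natCast, mul_comm]

lemma averageLength_eq_of_forall {Q : Channel A B} {C : Finset (List A)} (hC : C.Nonempty) {l : ℝ}
    (h : ∀ x ∈ C, (meanLength Q x).toReal = l) : averageLength Q C = l := by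
  have : (C.card : ℝ) ≠ 0 := by exact_mod_cast hC.card_pos.ne'
  rw [averageLength_eq, Finset.sum_congr rfl h, Finset.sum_const, nsmul_eq_mul]
  field_simp

lemma meanLength_memoryless (V : A → PMF B) (x : List A) :
    meanLength (memoryless V) x = x.length := by
  rw [meanLength, expect_congr (g := fun _ => (x.length : ℝ≥0∞)), expect_const]
  intro z hz
  rw [memoryless_pos_iff] at hz
  rw [hz.length_eq]

lemma codeRate_memoryless {V : A → PMF B} {n : ℕ} {C : Finset (List A)}
    (h : IsZeroErrorCode (memoryless V) n C) :
    codeRate (memoryless V) C = 1 / (n : ℝ) * Real.logb 2 (C.card : ℝ) := by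
  rw [codeRate, averageLength_eq_of_forall h.1 (l := n)]
  intro x hx
  rw [meanLength_memoryless, h.2.1 x hx]
  simp

/-- The noise does not change the length, so only the queue matters for it. -/
lemma meanLength_noisyQueue {K : ℕ} (φ : PMF (Fin (K + 1))) (V : A → PMF B)
    (x : List (Option A)) : meanLength (noisyQueue φ V) x = meanLength (queue φ) x := by
  rw [meanLength, noisyQueue, expect_bind, meanLength]
  congr 1
  funext z
  exact (packetNoise_eq_memoryless V ▸ meanLength_memoryless (slotNoise V) z)

/-- The mean of the slot in which the output ends, for the queue run from the state `(t, j)`. -/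
def meanEnd {K : ℕ} (φ : PMF (Fin (K + 1))) (t j : ℕ) (x : List (Option A)) : ℝ≥0∞ :=
  expect (queueFrom φ t j x) fun z => ((j + z.length : ℕ) : ℝ≥0∞)

/-- The mean processing time, in `[0, ∞]`. -/
def meanService {K : ℕ} (φ : PMF (Fin (K + 1))) : ℝ≥0∞ := expect φ fun k => ((k : ℕ) : ℝ≥0∞)

section meanEnd

variable {K : ℕ} (φ : PMF (Fin (K + 1)))

lemma meanService_ne_top : meanService φ ≠ ∞ := by
  rw [meanService, expect, tsum_fintype]
  exact ENNReal.sum_ne_top.2 fun k _ =>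
    ENNReal.mul_ne_top (φ.apply_ne_top k) (ENNReal.natCast_ne_top _)

lemma toReal_meanService : (meanService φ).toReal = meanProcessingTime φ := by
  rw [meanService, expect, tsum_fintype, ENNReal.toReal_sum fun k _ =>
    ENNReal.mul_ne_top (φ.apply_ne_top k) (ENNReal.natCast_ne_top _)]
  simp [meanProcessingTime, mul_comm]

lemma meanProcessingTime_nonneg : 0 ≤ meanProcessingTime φ := by
  rw [← toReal_meanService]; exact ENNReal.toReal_nonneg

lemma expect_service_add (c : ℕ) : expect φ (fun k => ((c + (k : ℕ) : ℕ) : ℝ≥0∞)) =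
    c + meanService φ := by
  simp only [Nat.cast_add, expect_add, expect_const, meanService]

lemma meanLength_queue (x : List (Option A)) : meanLength (queue φ) x = meanEnd φ 0 0 x := by
  simp [meanLength, meanEnd, queue]

lemma meanEnd_nil (t j : ℕ) :
    meanEnd φ t j ([] : List (Option A)) = ((max t j : ℕ) : ℝ≥0∞) := by
  rw [meanEnd, queueFrom, expect_pure, List.length_replicate]
  congr 1
  omega

lemma meanEnd_none (t j : ℕ) (x : List (Option A)) :
    meanEnd φ t j (none :: x) = meanEnd φ (t + 1) j x := by
  rw [meanEnd, queueFrom, meanEnd]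

/-- The departure slot of the first packet is the new state; the slots before it cancel out. -/
lemma meanEnd_some (t j : ℕ) (a : A) (x : List (Option A)) :
    meanEnd φ t j (some a :: x) =
      expect φ fun k => meanEnd φ (t + 1) (max (t + 1) (j + 1) + (k : ℕ)) x := by
  rw [meanEnd, queueFrom, expect_bind]
  congr 1
  funext k
  rw [expect_map, meanEnd]
  congr 1
  funext z
  congr 1
  simp only [List.length_append, List.length_replicate, List.length_cons]
  omega

lemma meanEnd_le (t j : ℕ) (x : List (Option A)) :
    meanEnd φ t j x ≤ ((max t j + x.length * (K + 1) : ℕ) : ℝ≥0∞) := by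
  induction x generalizing t j with
  | nil => simp [meanEnd_nil]
  | cons s x ih =>
    rcases s with _ | a
    · rw [meanEnd_none]
      refine (ih _ _).trans (Nat.cast_le.2 ?_)
      rw [List.length_cons, add_mul]
      omega
    · rw [meanEnd_some]
      refine (expect_mono fun k _ => ?_).trans (expect_const φ _).le
      refine (ih _ _).trans (Nat.cast_le.2 ?_)
      rw [List.length_cons, add_mul]
      omega

/-- Departures are at least one slot apart, so every packet delays the end of the output by at
least its processing time plus one. -/
lemma max_add_le_meanEnd (t j : ℕ) (x : List (Option A)) :
    ((max t j : ℕ) : ℝ≥0∞) + x.reduceOption.length * (1 + meanService φ) ≤ meanEnd φ t j x := by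
  induction x generalizing t j with
  | nil => simp [meanEnd_nil]
  | cons s x ih =>
    rcases s with _ | a
    · rw [meanEnd_none, List.reduceOption_cons_of_none]
      refine le_trans ?_ (ih (t + 1) j)
      gcongr
      omega
    · rw [meanEnd_some, List.reduceOption_cons_of_some, List.length_cons]
      calc _ = expect φ (fun k => ((max t j + 1 + (k : ℕ) : ℕ) : ℝ≥0∞) +
              x.reduceOption.length * (1 + meanService φ)) := by
            rw [expect_add, expect_service_add, expect_const]
            push_cast
            ring
        _ ≤ _ := expect_mono fun k _ => by
            refine le_trans ?_ (ih _ _)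
            gcongr
            omega

/-- The packets that arrive after the first part `u` of the input occupy the server after that
part. -/
lemma length_add_le_meanEnd (t j : ℕ) (u v : List (Option A)) :
    ((t + u.length : ℕ) : ℝ≥0∞) + v.reduceOption.length * (1 + meanService φ) ≤
      meanEnd φ t j (u ++ v) := by
  induction u generalizing t j with
  | nil =>
    refine le_trans ?_ (max_add_le_meanEnd φ t j v)
    gcongr
    simp
  | cons s u ih =>
    have key : ∀ j', ((t + (s :: u).length : ℕ) : ℝ≥0∞) +
        v.reduceOption.length * (1 + meanService φ) ≤ meanEnd φ (t + 1) j' (u ++ v) := by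
      intro j'
      refine le_trans (le_of_eq ?_) (ih (t + 1) j')
      rw [List.length_cons, add_right_comm, add_assoc t]
    rw [List.cons_append]
    rcases s with _ | a
    · rw [meanEnd_none]
      exact key j
    · rw [meanEnd_some]
      exact le_expect fun k => key _

/-- A server that never idles needs exactly the processing time plus one for each packet. -/
lemma meanEnd_map_some (t j : ℕ) (h : t ≤ j) (w : List A) :
    meanEnd φ t j (w.map some) = j + w.length * (1 + meanService φ) := by
  induction w generalizing t j with
  | nil => simp [meanEnd_nil, h]
  | cons a w ih =>
    rw [List.map_cons, meanEnd_some, List.length_cons]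
    calc _ = expect φ (fun k => ((j + 1 + (k : ℕ) : ℕ) : ℝ≥0∞) +
              w.length * (1 + meanService φ)) := by
            refine expect_congr fun k _ => ?_
            rw [ih _ _ (by omega)]
            congr 3
            omega
      _ = _ := by
            rw [expect_add, expect_service_add, expect_const]
            push_cast
            ring

end meanEnd

/-- Every part of the input contributes its duration or the service of its packets to the mean
output length. -/
lemma le_meanLength_toReal {K : ℕ} (φ : PMF (Fin (K + 1))) (V : A → PMF B)
    (x : List (Option A)) {s : ℕ} (hs : s ≤ x.length) :
    (s : ℝ) + (x.drop s).reduceOption.length * (meanProcessingTime φ + 1) ≤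
      (meanLength (noisyQueue φ V) x).toReal := by
  rw [meanLength_noisyQueue, meanLength_queue]
  have h := length_add_le_meanEnd φ 0 0 (x.take s) (x.drop s)
  rw [List.take_append_drop] at h
  have hfin : meanEnd φ 0 0 x ≠ ∞ :=
    ne_top_of_le_ne_top (ENNReal.natCast_ne_top _) (meanEnd_le φ 0 0 x)
  have h1 : (1 + meanService φ) ≠ ∞ := by simp [meanService_ne_top]
  have h2 := ENNReal.toReal_mono hfin h
  rw [ENNReal.toReal_add (by simp) (ENNReal.mul_ne_top (by simp) h1), ENNReal.toReal_mul,
    ENNReal.toReal_add (by simp) (meanService_ne_top φ), toReal_meanService] at h2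
  simpa [hs, add_comm (1 : ℝ)] using h2

/-! ### Zero-error codes for the memoryless channel -/

lemma forall₂_of_forall₂_append {α β : Type*} {R : α → β → Prop} {u v : List α} {u' v' : List β}
    (hl : u.length = u'.length) (h : List.Forall₂ R (u ++ v) (u' ++ v')) :
    List.Forall₂ R u u' ∧ List.Forall₂ R v v' := by
  have h1 := List.forall₂_take_append _ _ _ h
  have h2 := List.forall₂_drop_append _ _ _ h
  rw [← hl, List.take_left] at h1
  rw [← hl, List.drop_left] at h2
  exact ⟨h1, h2⟩

open Classical in
lemma IsZeroErrorCode.append {V : A → PMF B} {m n : ℕ} {C D : Finset (List A)}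
    (hC : IsZeroErrorCode (memoryless V) m C) (hD : IsZeroErrorCode (memoryless V) n D) :
    ∃ E : Finset (List A), IsZeroErrorCode (memoryless V) (m + n) E ∧
      E.card = C.card * D.card := by
  rw [isZeroErrorCode_memoryless_iff] at hC hD
  obtain ⟨hC0, hCl, hC⟩ := hC
  obtain ⟨hD0, hDl, hD⟩ := hD
  refine ⟨Finset.image₂ (· ++ ·) C D, ?_, ?_⟩
  · rw [isZeroErrorCode_memoryless_iff]
    refine ⟨hC0.image₂ hD0, ?_, ?_⟩
    · intro x hx
      obtain ⟨u, hu, v, hv, rfl⟩ := Finset.mem_image₂.1 hx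
      rw [List.length_append, hCl u hu, hDl v hv]
    · intro x hx y hy h
      obtain ⟨u, hu, v, hv, rfl⟩ := Finset.mem_image₂.1 hx
      obtain ⟨u', hu', v', hv', rfl⟩ := Finset.mem_image₂.1 hy
      obtain ⟨h1, h2⟩ := forall₂_of_forall₂_append ((hCl u hu).trans (hCl u' hu').symm) h
      rw [hC u hu u' hu' h1, hD v hv v' hv' h2]
  · refine Finset.card_image₂_iff.2 ?_
    rintro ⟨u, v⟩ huv ⟨u', v'⟩ huv' h
    simp only [Set.mem_prod, Finset.mem_coe] at huv huv'
    obtain ⟨rfl, rfl⟩ := List.append_inj h ((hCl u huv.1).trans (hCl u' huv'.1).symm)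
    rfl

lemma isZeroErrorCode_singleton (V : A → PMF B) (x : List A) :
    IsZeroErrorCode (memoryless V) x.length {x} := by
  rw [isZeroErrorCode_memoryless_iff]
  simp

lemma IsZeroErrorCode.pow {V : A → PMF B} {m : ℕ} {C : Finset (List A)}
    (hC : IsZeroErrorCode (memoryless V) m C) (k : ℕ) :
    ∃ E : Finset (List A), IsZeroErrorCode (memoryless V) (k * m) E ∧ E.card = C.card ^ k := by
  induction k with
  | zero => exact ⟨{[]}, by simpa using isZeroErrorCode_singleton V [], by simp⟩
  | succ k ih =>
    obtain ⟨E, hE, hEc⟩ := ih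
    obtain ⟨F, hF, hFc⟩ := hE.append hC
    exact ⟨F, by rwa [add_mul, one_mul], by rw [hFc, hEc, pow_succ]⟩

/-- The capacity bounds the size of the codes of every length, since the powers of a code have its
rate. -/
lemma card_le_pow_of_zeroErrorCapacity_eq {V : A → PMF B} {C₀ : ℝ}
    (hC₀ : zeroErrorCapacity (memoryless V) = (C₀ : EReal)) {m : ℕ} {C : Finset (List A)}
    (hC : IsZeroErrorCode (memoryless V) m C) : (C.card : ℝ) ≤ ((2 : ℝ) ^ C₀) ^ m := by
  have hpos : (0 : ℝ) < C.card := by exact_mod_cast hC.1.card_pos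
  rcases Nat.eq_zero_or_pos m with rfl | hm
  · have : C ⊆ {[]} := fun x hx => by
      simpa using List.length_eq_zero_iff.1 (hC.2.1 x hx)
    have := Finset.card_le_card this
    rw [Finset.card_singleton] at this
    simpa using this
  have hm' : (0 : ℝ) < m := by exact_mod_cast hm
  have key : ((Real.logb 2 C.card / m : ℝ) : EReal) ≤ (C₀ : EReal) := by
    rw [← hC₀]
    refine Filter.le_limsup_of_frequently_le ?_
    rw [Filter.frequently_atTop]
    intro N
    refine ⟨(N + 1) * m, by nlinarith, ?_⟩
    obtain ⟨E, hE, hEc⟩ := hC.pow (N + 1)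
    refine le_iSup₂_of_le E hE (le_of_eq ?_)
    rw [codeRate_memoryless hE, hEc, Nat.cast_pow, Real.logb_pow, Nat.cast_mul]
    congr 1
    field_simp
  rw [EReal.coe_le_coe_iff, div_le_iff₀ hm', Real.logb_le_iff_le_rpow (by norm_num) hpos,
    Real.rpow_mul (by norm_num), Real.rpow_natCast] at key
  exact key

/-- Below capacity there are codes of every length, up to a constant factor in their size. -/
lemma exists_code_of_lt_zeroErrorCapacity [Nonempty A] {V : A → PMF B} {C₀ c : ℝ}
    (hC₀ : zeroErrorCapacity (memoryless V) = (C₀ : EReal)) (hc : c < C₀) :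
    ∃ M : ℝ, 0 < M ∧ ∀ m : ℕ, ∃ C : Finset (List A), IsZeroErrorCode (memoryless V) m C ∧
      ((2 : ℝ) ^ c) ^ m ≤ M * C.card := by
  have hlt : (c : EReal) < zeroErrorCapacity (memoryless V) := by
    rw [hC₀]; exact EReal.coe_lt_coe hc
  have hfr := Filter.frequently_lt_of_lt_limsup (by isBoundedDefault) hlt
  obtain ⟨l, hl, hlt⟩ := (Filter.frequently_atTop.1 hfr) 1
  simp only [lt_iSup_iff] at hlt
  obtain ⟨C, hC, hrate⟩ := hlt
  have hl0 : (0 : ℝ) < l := by exact_mod_cast hl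
  have hcard : (0 : ℝ) < C.card := by exact_mod_cast hC.1.card_pos
  have hCl : ((2 : ℝ) ^ c) ^ l ≤ C.card := by
    rw [EReal.coe_lt_coe_iff, codeRate_memoryless hC, one_div_mul_eq_div, lt_div_iff₀ hl0] at hrate
    rw [← Real.rpow_natCast, ← Real.rpow_mul (by norm_num)]
    exact (Real.le_logb_iff_rpow_le (by norm_num) hcard).1 hrate.le
  have h2c : (0 : ℝ) < (2 : ℝ) ^ c := by positivity
  -- The remainder of the length modulo `l` is filled with a constant word.
  refine ⟨∑ r ∈ Finset.range l, ((2 : ℝ) ^ c) ^ r,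
    Finset.sum_pos (fun r _ => by positivity) ⟨0, Finset.mem_range.2 hl⟩, fun m => ?_⟩
  obtain ⟨E, hE, hEc⟩ := hC.pow (m / l)
  have a : A := Classical.arbitrary A
  obtain ⟨F, hF, hFc⟩ := hE.append (isZeroErrorCode_singleton V (List.replicate (m % l) a))
  rw [List.length_replicate, Nat.div_add_mod'] at hF
  refine ⟨F, hF, ?_⟩
  rw [hFc, hEc, Finset.card_singleton, mul_one]
  calc ((2 : ℝ) ^ c) ^ m = ((2 : ℝ) ^ c) ^ (m % l) * (((2 : ℝ) ^ c) ^ l) ^ (m / l) := by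
        rw [← pow_mul, ← pow_add, Nat.mod_add_div]
    _ ≤ _ := by
        push_cast
        gcongr
        exact Finset.single_le_sum (f := fun r => ((2 : ℝ) ^ c) ^ r) (fun r _ => by positivity)
          (Finset.mem_range.2 (Nat.mod_lt _ hl))

/-! ### Codes for the noisy queue -/

/-- The queue neither loses packets nor changes their order. -/
lemma reduceOption_of_queueFrom_pos {K : ℕ} {φ : PMF (Fin (K + 1))} {t j : ℕ}
    {x z : List (Option A)} (h : 0 < queueFrom φ t j x z) :
    z.reduceOption = x.reduceOption := by
  induction x generalizing t j z with
  | nil =>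
    rw [queueFrom, pure_pos_iff] at h
    rw [h, List.reduceOption_replicate_none, List.reduceOption_nil]
  | cons s x ih =>
    rcases s with _ | a
    · rw [queueFrom] at h
      rw [ih h, List.reduceOption_cons_of_none]
    · rw [queueFrom, bind_pos_iff] at h
      obtain ⟨k, _, h⟩ := h
      rw [map_pos_iff] at h
      obtain ⟨z', hz', rfl⟩ := h
      rw [List.reduceOption_append, List.reduceOption_replicate_none, List.nil_append,
        List.reduceOption_cons_of_some, List.reduceOption_cons_of_some, ih hz']

open Classical in
/-- A code for the memoryless channel is used over the noisy queue by sending a packet in every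
slot. -/
lemma IsZeroErrorCode.map_some {K : ℕ} (φ : PMF (Fin (K + 1))) {V : A → PMF B} {n : ℕ}
    {C : Finset (List A)} (hC : IsZeroErrorCode (memoryless V) n C) :
    IsZeroErrorCode (noisyQueue φ V) n (C.image (List.map some)) ∧
      codeRate (noisyQueue φ V) (C.image (List.map some)) =
        codeRate (memoryless V) C / (meanProcessingTime φ + 1) := by
  have hrate := codeRate_memoryless hC
  rw [isZeroErrorCode_memoryless_iff] at hC
  obtain ⟨hC0, hCl, hC⟩ := hC
  refine ⟨⟨hC0.image _, ?_, ?_⟩, ?_⟩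
  · simp only [Finset.forall_mem_image, List.length_map]
    exact hCl
  · simp only [Finset.forall_mem_image]
    intro x hx y hy hne w hw
    obtain ⟨z, z', hz, hz', h⟩ := (exists_noisyQueue_pos_iff φ V _ _).1 ⟨w, hw⟩
    have h := forall₂_reduceOption h
    rw [reduceOption_of_queueFrom_pos hz, reduceOption_of_queueFrom_pos hz'] at h
    simp only [List.reduceOption, List.filterMap_map, Function.comp_def, id,
      List.filterMap_some] at h
    exact hne (by rw [hC x hx y hy h])
  · rw [hrate, codeRate, averageLength_eq_of_forall (hC0.image _)
      (l := n * (meanProcessingTime φ + 1))]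
    · rw [Finset.card_image_of_injective _ (List.map_injective_iff.2 (Option.some_injective A))]
      simp only [div_eq_mul_inv, mul_inv, one_mul]
      ring
    · simp only [Finset.forall_mem_image]
      intro x hx
      rw [meanLength_noisyQueue, meanLength_queue, meanEnd_map_some φ 0 0 le_rfl, hCl x hx,
        Nat.cast_zero, zero_add, ENNReal.toReal_mul,
        ENNReal.toReal_add (by simp) (meanService_ne_top φ), toReal_meanService]
      simp [add_comm]

/-- The input in which each letter of `u` occupies a block of `K + 1` slots: a packet is sent in the
first slot of its block, so that it departs within the block. -/
def spread (K : ℕ) : List (Option A) → List (Option A)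
  | [] => []
  | s :: u => s :: (List.replicate K none ++ spread K u)

/-- The word `z` consists of one block of `K + 1` slots for each letter of `u`, and the packets in
the block are those of that letter, in any slot. -/
def BlockOutput (K : ℕ) : List (Option A) → List (Option A) → Prop
  | [], z => z = []
  | s :: u, z => ∃ c z', z = c ++ z' ∧ c.length = K + 1 ∧ c.reduceOption = s.toList ∧
      BlockOutput K u z'

lemma length_spread (K : ℕ) (u : List (Option A)) :
    (spread K u).length = u.length * (K + 1) := by
  induction u with
  | nil => simp [spread]
  | cons s u ih =>
    rw [spread, List.length_cons, List.length_append, List.length_replicate, ih, List.length_cons]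
    ring

lemma spread_injective (K : ℕ) : Function.Injective (spread K : List (Option A) → _) := by
  intro u v h
  induction u generalizing v with
  | nil => cases v <;> simp [spread] at h ⊢
  | cons s u ih =>
    cases v with
    | nil => simp [spread] at h
    | cons s' v =>
      rw [spread, spread, List.cons.injEq, List.append_cancel_left_eq] at h
      rw [h.1, ih h.2]

lemma queueFrom_replicate_none_append {K : ℕ} (φ : PMF (Fin (K + 1))) (t j r : ℕ)
    (x : List (Option A)) :
    queueFrom φ t j (List.replicate r none ++ x) = queueFrom φ (t + r) j x := by
  induction r generalizing t with
  | zero => rfl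
  | succ r ih =>
    rw [List.replicate_succ, List.cons_append, queueFrom, ih]
    congr 1
    ring

lemma exists_blockOutput_of_queueFrom_pos {K : ℕ} {φ : PMF (Fin (K + 1))} {t j : ℕ} (hj : j ≤ t)
    {u z : List (Option A)} (h : 0 < queueFrom φ t j (spread K u) z) :
    ∃ z', z = List.replicate (t - j) none ++ z' ∧ BlockOutput K u z' := by
  induction u generalizing t j z with
  | nil =>
    rw [spread, queueFrom, pure_pos_iff] at h
    exact ⟨[], by rw [h, List.append_nil], rfl⟩
  | cons s u ih =>
    rw [spread] at h
    rcases s with _ | a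
    · rw [queueFrom, queueFrom_replicate_none_append] at h
      obtain ⟨z', rfl, hz'⟩ := ih (by omega) h
      refine ⟨List.replicate (K + 1) none ++ z', ?_, _, z', rfl, by simp,
        by rw [List.reduceOption_replicate_none]; rfl, hz'⟩
      rw [← List.append_assoc, List.replicate_append_replicate]
      congr 2
      omega
    · rw [queueFrom, bind_pos_iff] at h
      obtain ⟨k, _, h⟩ := h
      rw [map_pos_iff] at h
      obtain ⟨z₁, hz₁, rfl⟩ := h
      rw [queueFrom_replicate_none_append] at hz₁
      have hk := k.2
      obtain ⟨z', rfl, hz'⟩ := ih (by omega) hz₁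
      refine ⟨(List.replicate k none ++ some a :: List.replicate (K - k) none) ++ z', ?_, _, z',
        rfl, ?_, ?_, hz'⟩
      · rw [← List.append_assoc, ← List.append_assoc, List.replicate_append_replicate,
          List.append_assoc, List.cons_append]
        have h1 : max (t + 1) (j + 1) + (k : ℕ) - (j + 1) = t - j + k := by omega
        have h2 : t + 1 + K - (max (t + 1) (j + 1) + (k : ℕ)) = K - k := by omega
        rw [h1, h2]
      · simp only [List.length_append, List.length_cons, List.length_replicate]
        omega
      · rw [List.reduceOption_append, List.reduceOption_cons_of_some,
          List.reduceOption_replicate_none, List.reduceOption_replicate_none]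
        rfl

lemma BlockOutput.length_eq {K : ℕ} {u z : List (Option A)} (h : BlockOutput K u z) :
    z.length = u.length * (K + 1) := by
  induction u generalizing z with
  | nil => rw [show z = [] from h]; simp
  | cons s u ih =>
    obtain ⟨c, z', rfl, hc, _, hz'⟩ := h
    rw [List.length_append, hc, ih hz', List.length_cons]
    ring

lemma BlockOutput.forall₂ {K : ℕ} {R : A → A → Prop} {u u' z z' : List (Option A)}
    (hu : BlockOutput K u z) (hu' : BlockOutput K u' z') (hl : u.length = u'.length)
    (h : List.Forall₂ (Option.Rel R) z z') : List.Forall₂ (Option.Rel R) u u' := by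
  induction u generalizing u' z z' with
  | nil => rw [List.length_eq_zero_iff.1 hl.symm]; exact .nil
  | cons s u ih =>
    obtain _ | ⟨s', u'⟩ := u'
    · simp at hl
    obtain ⟨c, z, rfl, hc, hcs, hz⟩ := hu
    obtain ⟨c', z', rfl, hc', hcs', hz'⟩ := hu'
    obtain ⟨h1, h2⟩ := forall₂_of_forall₂_append (hc.trans hc'.symm) h
    refine .cons ?_ (ih hz hz' (by simpa using hl) h2)
    have h3 := forall₂_reduceOption h1
    rw [hcs, hcs'] at h3
    rcases s with _ | a <;> rcases s' with _ | a' <;> simp at h3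
    · exact .none
    · exact .some h3

/-- The word with packets exactly at the places `true` of `s`, their types being read off from `w`
in order. If `w` is too short, the remaining places stay empty. -/
def fill : List Bool → List A → List (Option A)
  | [], _ => []
  | false :: s, w => none :: fill s w
  | true :: s, a :: w => some a :: fill s w
  | true :: s, [] => none :: fill s []

lemma length_fill (s : List Bool) (w : List A) : (fill s w).length = s.length := by
  induction s generalizing w with
  | nil => simp [fill]
  | cons b s ih => cases b <;> cases w <;> simp [fill, ih]

lemma eq_of_forall₂_fill {R : A → A → Prop} {s s' : List Bool} {w w' : List A}
    (hw : w.length = s.count true) (hw' : w'.length = s'.count true)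
    (h : List.Forall₂ (Option.Rel R) (fill s w) (fill s' w')) : s = s' ∧ List.Forall₂ R w w' := by
  induction s generalizing s' w w' with
  | nil =>
    have hs' : s' = [] := by simpa [length_fill] using h.length_eq.symm
    subst hs'
    simp only [List.count_nil, List.length_eq_zero_iff] at hw hw'
    subst hw hw'
    exact ⟨rfl, .nil⟩
  | cons b s ih =>
    obtain _ | ⟨b', s'⟩ := s'
    · simpa [length_fill] using h.length_eq
    rcases b <;> rcases b'
    · simp only [fill, List.forall₂_cons] at h
      obtain ⟨rfl, h'⟩ := ih (by simpa using hw) (by simpa using hw') h.2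
      exact ⟨rfl, h'⟩
    · obtain _ | ⟨a', w'⟩ := w'
      · simp at hw'
      simp only [fill, List.forall₂_cons] at h
      cases h.1
    · obtain _ | ⟨a, w⟩ := w
      · simp at hw
      simp only [fill, List.forall₂_cons] at h
      cases h.1
    · obtain _ | ⟨a, w⟩ := w
      · simp at hw
      obtain _ | ⟨a', w'⟩ := w'
      · simp at hw'
      simp only [fill, List.forall₂_cons] at h
      obtain ⟨h1, h2⟩ := h
      obtain ⟨rfl, h⟩ := ih (by simpa using hw) (by simpa using hw') h2
      cases h1 with
      | some h1 => exact ⟨rfl, .cons h1 h⟩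

lemma sum_pow_count_true (q : ℝ) (N : ℕ) :
    ∑ f : Fin N → Bool, q ^ (List.ofFn f).count true = (q + 1) ^ N := by
  induction N with
  | zero => simp
  | succ N ih =>
    rw [← (Fin.consEquiv fun _ => Bool).sum_comp, Fintype.sum_prod_type, Fintype.sum_bool]
    simp only [Fin.consEquiv, Equiv.coe_fn_mk, List.ofFn_succ, Fin.cons_zero, Fin.cons_succ,
      List.count_cons_self, List.count_cons_of_ne Bool.false_ne_true, pow_succ, ← Finset.sum_mul,
      ih]
    ring

open Classical in
/-- Codes of all lengths for the memoryless channel give a code over `N` blocks, in which the set of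
the nonempty blocks is arbitrary and carries information as well. -/
lemma exists_blockCode {K : ℕ} (φ : PMF (Fin (K + 1))) {V : A → PMF B}
    {C : ℕ → Finset (List A)} (hC : ∀ m, IsZeroErrorCode (memoryless V) m (C m)) (N : ℕ) :
    ∃ E : Finset (List (Option A)), IsZeroErrorCode (noisyQueue φ V) (N * (K + 1)) E ∧
      codeRate (noisyQueue φ V) E = 1 / ((N * (K + 1) : ℕ) : ℝ) * Real.logb 2 E.card ∧
      E.card = ∑ f : Fin N → Bool, (C ((List.ofFn f).count true)).card := by
  simp only [isZeroErrorCode_memoryless_iff] at hC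
  let S : Finset (Σ _ : Fin N → Bool, List A) :=
    Finset.univ.sigma fun f => C ((List.ofFn f).count true)
  let F : (Σ _ : Fin N → Bool, List A) → List (Option A) :=
    fun p => spread K (fill (List.ofFn p.1) p.2)
  have hS : ∀ p ∈ S, p.2 ∈ C ((List.ofFn p.1).count true) := fun p hp => (Finset.mem_sigma.1 hp).2
  have hconf : ∀ p ∈ S, ∀ p' ∈ S, List.Forall₂ (Option.Rel (Confusable V))
      (fill (List.ofFn p.1) p.2) (fill (List.ofFn p'.1) p'.2) → p = p' := by
    rintro ⟨f, w⟩ hp ⟨f', w'⟩ hp' h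
    obtain ⟨hf, h⟩ := eq_of_forall₂_fill ((hC _).2.1 _ (hS _ hp)) ((hC _).2.1 _ (hS _ hp')) h
    obtain rfl := List.ofFn_injective hf
    rw [(hC _).2.2 w (hS _ hp) w' (hS _ hp') h]
  have hrefl : ∀ u : List (Option A), List.Forall₂ (Option.Rel (Confusable V)) u u := by
    intro u
    refine List.forall₂_same.2 fun s _ => ?_
    rcases s with _ | a
    · exact .none
    · obtain ⟨b, hb⟩ := (V a).support_nonempty
      exact .some ⟨b, (pmf_pos_iff _ _).2 hb, (pmf_pos_iff _ _).2 hb⟩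
  have hinj : Set.InjOn F S := by
    intro p hp p' hp' h
    refine hconf p hp p' hp' ?_
    rw [spread_injective K h]
    exact hrefl _
  have hout : ∀ p : Σ _ : Fin N → Bool, List A, ∀ z, 0 < queue φ (F p) z →
      BlockOutput K (fill (List.ofFn p.1) p.2) z := by
    intro p z hz
    obtain ⟨z', rfl, hz'⟩ := exists_blockOutput_of_queueFrom_pos le_rfl hz
    simpa using hz'
  have hne : (S.image F).Nonempty := by
    refine Finset.Nonempty.image ?_ _
    obtain ⟨w, hw⟩ := (hC ((List.ofFn fun _ : Fin N => true).count true)).1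
    exact ⟨⟨fun _ => true, w⟩, Finset.mem_sigma.2 ⟨Finset.mem_univ _, hw⟩⟩
  refine ⟨S.image F, ⟨hne, ?_, ?_⟩, ?_, ?_⟩
  · simp only [Finset.forall_mem_image, F, length_spread, length_fill, List.length_ofFn,
      implies_true]
  · simp only [Finset.forall_mem_image]
    intro p hp p' hp' hpp' w hw
    obtain ⟨z, z', hz, hz', h⟩ := (exists_noisyQueue_pos_iff φ V _ _).1 ⟨w, hw⟩
    refine hpp' (congrArg F (hconf p hp p' hp' ((hout p z hz).forall₂ (hout p' z' hz') ?_ h)))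
    simp only [length_fill, List.length_ofFn]
  · rw [codeRate, averageLength_eq_of_forall hne (l := ((N * (K + 1) : ℕ) : ℝ))]
    simp only [Finset.forall_mem_image]
    intro p _
    rw [meanLength_noisyQueue, meanLength,
      expect_congr (g := fun _ => ((N * (K + 1) : ℕ) : ℝ≥0∞)), expect_const,
      ENNReal.toReal_natCast]
    intro z hz
    rw [(hout p z hz).length_eq, length_fill, List.length_ofFn]
  · rw [Finset.card_image_of_injOn hinj, Finset.card_sigma]

lemma le_limsup_of_tendsto {f : ℕ → EReal} {u : ℕ → ℝ} {a : ℝ} {g : ℕ → ℕ}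
    (hg : Filter.Tendsto g Filter.atTop Filter.atTop)
    (hu : Filter.Tendsto u Filter.atTop (nhds a))
    (h : ∀ᶠ N in Filter.atTop, (u N : EReal) ≤ f (g N)) :
    (a : EReal) ≤ Filter.limsup f Filter.atTop := by
  have hu' : Filter.Tendsto (fun N => (u N : EReal)) Filter.atTop (nhds (a : EReal)) :=
    (continuous_coe_real_ereal.tendsto a).comp hu
  rw [← hu'.limsup_eq]
  calc _ ≤ Filter.limsup (f ∘ g) Filter.atTop := Filter.limsup_le_limsup h
    _ = Filter.limsup f (Filter.map g Filter.atTop) := Filter.limsup_comp _ _ _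
    _ ≤ _ := Filter.limsup_le_limsup_of_le hg

lemma le_of_forall_lt_of_continuous {F : ℝ → ℝ} (hF : Continuous F) {a : ℝ} {x : EReal}
    (h : ∀ c < a, (F c : EReal) ≤ x) : (F a : EReal) ≤ x := by
  have hlim : Filter.Tendsto (fun c => (F c : EReal)) (nhdsWithin a (Set.Iio a))
      (nhds (F a : EReal)) :=
    ((continuous_coe_real_ereal.comp hF).tendsto a).mono_left nhdsWithin_le_nhds
  exact le_of_tendsto hlim (eventually_nhdsWithin_of_forall h)

/-- Timing and types together: the rate `log (2 ^ C₀ + 1) / (K + 1)` is achievable. -/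
lemma logb_div_le_zeroErrorCapacity_noisyQueue [Nonempty A] {K : ℕ} (φ : PMF (Fin (K + 1)))
    {V : A → PMF B} {C₀ : ℝ} (hC₀ : zeroErrorCapacity (memoryless V) = (C₀ : EReal)) :
    ((Real.logb 2 ((2 : ℝ) ^ C₀ + 1) / ((K : ℝ) + 1) : ℝ) : EReal) ≤
      zeroErrorCapacity (noisyQueue φ V) := by
  have hcont : Continuous fun c : ℝ => Real.logb 2 ((2 : ℝ) ^ c + 1) / ((K : ℝ) + 1) := by
    have h2 : Continuous fun c : ℝ => (2 : ℝ) ^ c + 1 :=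
      (Real.continuous_const_rpow (by norm_num)).add continuous_const
    exact (h2.logb fun c => by positivity).div_const _
  refine le_of_forall_lt_of_continuous hcont fun c hc => ?_
  obtain ⟨M, hM, hcode⟩ := exists_code_of_lt_zeroErrorCapacity hC₀ hc
  choose C hC hCM using hcode
  have hK : (0 : ℝ) < (K : ℝ) + 1 := by positivity
  have hlim : Filter.Tendsto (fun N : ℕ => Real.logb 2 ((2 : ℝ) ^ c + 1) / ((K : ℝ) + 1) -
      Real.logb 2 M / ((K : ℝ) + 1) / (N : ℝ)) Filter.atTop
      (nhds (Real.logb 2 ((2 : ℝ) ^ c + 1) / ((K : ℝ) + 1))) := by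
    simpa using (tendsto_const_nhds (x := Real.logb 2 ((2 : ℝ) ^ c + 1) / ((K : ℝ) + 1))).sub
      (tendsto_const_div_atTop_nhds_zero_nat (Real.logb 2 M / ((K : ℝ) + 1)))
  refine le_limsup_of_tendsto (g := fun N => N * (K + 1))
    (Filter.tendsto_id.atTop_mul_const' K.succ_pos) hlim ?_
  filter_upwards [Filter.eventually_gt_atTop 0] with N hN
  have hN' : (0 : ℝ) < N := by exact_mod_cast hN
  obtain ⟨E, hE, hrate, hcard⟩ := exists_blockCode φ hC N
  refine le_iSup₂_of_le E hE (EReal.coe_le_coe ?_)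
  have hEpos : (0 : ℝ) < E.card := by exact_mod_cast hE.1.card_pos
  have hbound : ((2 : ℝ) ^ c + 1) ^ N ≤ M * E.card := by
    rw [← sum_pow_count_true, hcard, Nat.cast_sum, Finset.mul_sum]
    exact Finset.sum_le_sum fun f _ => hCM _
  have hlog := Real.logb_le_logb_of_le (b := 2) (by norm_num) (by positivity) hbound
  rw [Real.logb_pow, Real.logb_mul hM.ne' hEpos.ne'] at hlog
  rw [hrate, one_div_mul_eq_div, le_div_iff₀ (by positivity)]
  push_cast
  field_simp
  linarith

/-- Types alone: the rate `C₀ / (E[κ] + 1)` is achievable by never letting the server idle. -/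
lemma div_le_zeroErrorCapacity_noisyQueue {K : ℕ} (φ : PMF (Fin (K + 1)))
    {V : A → PMF B} {C₀ : ℝ} (hC₀ : zeroErrorCapacity (memoryless V) = (C₀ : EReal)) :
    ((C₀ / (meanProcessingTime φ + 1) : ℝ) : EReal) ≤ zeroErrorCapacity (noisyQueue φ V) := by
  refine le_of_forall_lt_of_continuous (F := fun c => c / (meanProcessingTime φ + 1))
    (continuous_id.div_const _) fun c hc => ?_
  have hE := meanProcessingTime_nonneg φ
  have hlt : (c : EReal) < zeroErrorCapacity (memoryless V) := by
    rw [hC₀]; exact EReal.coe_lt_coe hc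
  refine Filter.le_limsup_of_frequently_le
    ((Filter.frequently_lt_of_lt_limsup (by isBoundedDefault) hlt).mono fun n hn => ?_)
  simp only [lt_iSup_iff, EReal.coe_lt_coe_iff] at hn
  obtain ⟨C, hC, hrate⟩ := hn
  obtain ⟨hD, hDrate⟩ := hC.map_some φ
  refine le_iSup₂_of_le _ hD (EReal.coe_le_coe ?_)
  rw [hDrate]
  gcongr

/-! ### Adversarial processing times -/

/-- Suppose that each processing time is chosen so that the packet departs at the end of a block of
`K + 1` slots; there is exactly one such choice. These are the numbers of the blocks at the ends of
which packets depart, if `t` input slots have been read and the last departure was at the end of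
block `b`. -/
def departureBlocks (K : ℕ) : ℕ → ℕ → List (Option A) → List ℕ
  | _, _, [] => []
  | t, b, none :: x => departureBlocks K (t + 1) b x
  | t, b, some _ :: x => max (t / (K + 1) + 1) (b + 1) ::
      departureBlocks K (t + 1) (max (t / (K + 1) + 1) (b + 1)) x

/-- The word, from slot `j + 1` on, with the given departures (slots and packet types), filled up
with empty slots to slot `n`. -/
def render (n : ℕ) : ℕ → List (ℕ × A) → List (Option A)
  | j, [] => List.replicate (n - j) none
  | j, (d, a) :: l => List.replicate (d - (j + 1)) none ++ some a :: render n d l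

lemma length_departureBlocks (K t b : ℕ) (x : List (Option A)) :
    (departureBlocks K t b x).length = x.reduceOption.length := by
  induction x generalizing t b with
  | nil => rfl
  | cons s x ih => rcases s with _ | a <;> simp [departureBlocks, ih]

lemma queueFrom_render_pos {K : ℕ} {φ : PMF (Fin (K + 1))} (hφ : ∀ k, 0 < φ k) (t b : ℕ)
    (x : List (Option A)) :
    0 < queueFrom φ t (b * (K + 1)) x (render (t + x.length) (b * (K + 1))
      (((departureBlocks K t b x).map (· * (K + 1))).zip x.reduceOption)) := by
  induction x generalizing t b with
  | nil => rw [queueFrom, pure_pos_iff]; rfl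
  | cons s x ih =>
    rcases s with _ | a
    · rw [queueFrom, departureBlocks, List.reduceOption_cons_of_none, List.length_cons,
        Nat.add_comm x.length, ← Nat.add_assoc]
      exact ih _ _
    · rw [queueFrom, departureBlocks, List.reduceOption_cons_of_some, List.length_cons,
        Nat.add_comm x.length, ← Nat.add_assoc, bind_pos_iff]
      set b' := max (t / (K + 1) + 1) (b + 1) with hb'
      have h1 : max (t + 1) (b * (K + 1) + 1) ≤ b' * (K + 1) := by
        have h2 := Nat.lt_div_mul_add (a := t) K.succ_pos
        have h3 : (t / (K + 1) + 1) * (K + 1) ≤ b' * (K + 1) :=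
          Nat.mul_le_mul_right _ (le_max_left _ _)
        have h4 : (b + 1) * (K + 1) ≤ b' * (K + 1) := Nat.mul_le_mul_right _ (le_max_right _ _)
        rw [add_mul, one_mul] at h3 h4
        simp only [Nat.succ_eq_add_one] at h2
        omega
      have h5 : b' * (K + 1) ≤ max (t + 1) (b * (K + 1) + 1) + K := by
        have h6 := Nat.div_mul_le_self t (K + 1)
        rcases max_choice (t / (K + 1) + 1) (b + 1) with h | h <;> rw [hb', h, add_mul, one_mul] <;>
          omega
      refine ⟨⟨b' * (K + 1) - max (t + 1) (b * (K + 1) + 1), by omega⟩, hφ _, ?_⟩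
      simp only [Nat.add_sub_cancel' h1]
      rw [map_pos_iff]
      exact ⟨_, ih (t + 1) b', rfl⟩

lemma forall₂_render {R : A → A → Prop} (n j : ℕ) (D : List ℕ) {w w' : List A}
    (h : List.Forall₂ R w w') :
    List.Forall₂ (Option.Rel R) (render n j (D.zip w)) (render n j (D.zip w')) := by
  have hrep : ∀ r : ℕ, List.Forall₂ (Option.Rel R) (List.replicate r none)
      (List.replicate r none) := fun r => List.forall₂_same.2 fun s hs => by
    rw [List.eq_of_mem_replicate hs]; exact .none
  induction D generalizing j w w' with
  | nil => exact hrep _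
  | cons d D ih =>
    cases h with
    | nil => exact hrep _
    | cons h1 h2 => exact List.rel_append (hrep _) (.cons (.some h1) (ih d h2))

/-- Under the adversarial processing times the timing of the output depends on the departure blocks
only, so that codewords with the same departure blocks are told apart by the packet types. -/
lemma IsZeroErrorCode.eq_of_departureBlocks_eq {K : ℕ} {φ : PMF (Fin (K + 1))}
    (hφ : ∀ k, 0 < φ k) {V : A → PMF B} {n : ℕ} {C : Finset (List (Option A))}
    (hC : IsZeroErrorCode (noisyQueue φ V) n C) {x y : List (Option A)} (hx : x ∈ C) (hy : y ∈ C)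
    (hD : departureBlocks K 0 0 x = departureBlocks K 0 0 y)
    (h : List.Forall₂ (Confusable V) x.reduceOption y.reduceOption) : x = y := by
  by_contra hne
  have hpos := queueFrom_render_pos (A := A) hφ 0 0
  simp only [zero_mul, zero_add] at hpos
  have hxz := hpos x
  have hyz := hpos y
  rw [hC.2.1 x hx] at hxz
  rw [hC.2.1 y hy, ← hD] at hyz
  obtain ⟨w, hw⟩ := (exists_noisyQueue_pos_iff φ V x y).2
    ⟨_, _, hxz, hyz, forall₂_render n 0 _ h⟩
  exact hC.2.2 x hx y hy hne w hw

open Classical in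
lemma IsZeroErrorCode.card_le_of_departureBlocks_eq {K : ℕ} {φ : PMF (Fin (K + 1))}
    (hφ : ∀ k, 0 < φ k) {V : A → PMF B} {C₀ : ℝ}
    (hC₀ : zeroErrorCapacity (memoryless V) = (C₀ : EReal)) {n : ℕ} {C T : Finset (List (Option A))}
    (hC : IsZeroErrorCode (noisyQueue φ V) n C) (hT : T ⊆ C) {D : List ℕ}
    (hD : ∀ x ∈ T, departureBlocks K 0 0 x = D) :
    (T.card : ℝ) ≤ ((2 : ℝ) ^ C₀) ^ D.length := by
  have key : ∀ x ∈ T, ∀ y ∈ T, List.Forall₂ (Confusable V) x.reduceOption y.reduceOption → x = y :=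
    fun x hx y hy h => hC.eq_of_departureBlocks_eq hφ (hT hx) (hT hy)
      ((hD x hx).trans (hD y hy).symm) h
  have hinj : Set.InjOn List.reduceOption (T : Set (List (Option A))) := by
    intro x hx y hy h
    refine key x hx y hy ?_
    rw [h]
    refine List.forall₂_same.2 fun a _ => ?_
    obtain ⟨b, hb⟩ := (V a).support_nonempty
    exact ⟨b, (pmf_pos_iff _ _).2 hb, (pmf_pos_iff _ _).2 hb⟩
  rcases T.eq_empty_or_nonempty with rfl | hne
  · simp only [Finset.card_empty, Nat.cast_zero]
    positivity
  rw [← Finset.card_image_of_injOn hinj]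
  refine card_le_pow_of_zeroErrorCapacity_eq hC₀ ?_
  rw [isZeroErrorCode_memoryless_iff]
  refine ⟨hne.image _, ?_, ?_⟩
  · simp only [Finset.forall_mem_image]
    intro x hx
    rw [← length_departureBlocks K 0 0, hD x hx]
  · simp only [Finset.forall_mem_image]
    intro x hx y hy h
    rw [key x hx y hy h]

/-! ### The structure of the departure blocks -/

lemma lt_of_mem_departureBlocks {K t b : ℕ} {x : List (Option A)} {c : ℕ}
    (hc : c ∈ departureBlocks K t b x) : t / (K + 1) < c ∧ b < c := by
  induction x generalizing t b with
  | nil => simp [departureBlocks] at hc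
  | cons s x ih =>
    have hmono : t / (K + 1) ≤ (t + 1) / (K + 1) := Nat.div_le_div_right (Nat.le_succ t)
    rcases s with _ | a
    · have := ih hc
      omega
    · rw [departureBlocks, List.mem_cons] at hc
      rcases hc with rfl | hc
      · omega
      · have := ih hc
        omega

lemma pairwise_departureBlocks (K t b : ℕ) (x : List (Option A)) :
    (departureBlocks K t b x).Pairwise (· < ·) := by
  induction x generalizing t b with
  | nil => exact .nil
  | cons s x ih =>
    rcases s with _ | a
    · exact ih _ _
    · exact List.pairwise_cons.2 ⟨fun c hc => (lt_of_mem_departureBlocks hc).2, ih _ _⟩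

/-- After the last arrival the server does not idle until all packets have departed. -/
lemma pred_mem_departureBlocks {K t b : ℕ} {x : List (Option A)} {c : ℕ}
    (hc : c ∈ departureBlocks K t b x) (hlt : (t + x.length) / (K + 1) + 1 < c) :
    c - 1 ∈ departureBlocks K t b x ∨ c - 1 = b := by
  induction x generalizing t b with
  | nil => simp [departureBlocks] at hc
  | cons s x ih =>
    have hmono : t / (K + 1) ≤ (t + (s :: x).length) / (K + 1) :=
      Nat.div_le_div_right (Nat.le_add_right _ _)
    rw [List.length_cons, Nat.add_comm x.length, ← Nat.add_assoc] at hlt hmono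
    rcases s with _ | a
    · exact ih hc hlt
    · rw [departureBlocks, List.mem_cons] at hc ⊢
      rcases hc with rfl | hc
      · omega
      · have := ih hc hlt
        tauto

/-- If no packet departs at the end of block `c`, then the queue is empty there, so that the packets
departing later are those arriving later. -/
lemma length_filter_departureBlocks {K t b c d : ℕ} {x : List (Option A)}
    (hc : c ∉ departureBlocks K t b x) (ht : t + d = c * (K + 1)) (hb : 0 < d → b < c) :
    ((departureBlocks K t b x).filter (c < ·)).length = (x.drop d).reduceOption.length := by
  induction x generalizing t b d with
  | nil => simp [departureBlocks]
  | cons s x ih =>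
    rcases d with _ | d
    · have htc : t / (K + 1) = c := by
        rw [show t = c * (K + 1) from ht, Nat.mul_div_cancel _ K.succ_pos]
      rw [List.filter_eq_self.2, length_departureBlocks, List.drop_zero]
      intro e he
      simpa [htc] using (lt_of_mem_departureBlocks he).1
    · have hb := hb (Nat.succ_pos d)
      rw [List.drop_succ_cons]
      rcases s with _ | a
      · exact ih hc (by omega) fun _ => hb
      · rw [departureBlocks, List.mem_cons, not_or] at hc
        have htc : t / (K + 1) < c := (Nat.div_lt_iff_lt_mul K.succ_pos).2 (by
          simp only [Nat.succ_eq_add_one]; omega)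
        have hlt : max (t / (K + 1) + 1) (b + 1) < c := by
          have := hc.1
          omega
        rw [departureBlocks, List.filter_cons_of_neg (by simpa using hlt.le)]
        exact ih hc.2 (by omega) fun _ => hlt

/-- The set of the blocks at the ends of which packets depart, under the adversarial processing
times. -/
def departureSet (K : ℕ) (x : List (Option A)) : Finset ℕ := (departureBlocks K 0 0 x).toFinset

/-- The last of the blocks `0, …, N` that is not in `S`. A departure set never contains `0`, so block
`0`, which ends before the first slot, serves as the default. -/
def lastIdle (N : ℕ) (S : Finset ℕ) : ℕ := Nat.findGreatest (· ∉ S) N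

lemma departureBlocks_eq_of_departureSet_eq {K : ℕ} {x y : List (Option A)}
    (h : departureSet K x = departureSet K y) :
    departureBlocks K 0 0 x = departureBlocks K 0 0 y :=
  (pairwise_departureBlocks K 0 0 x).eq_of_mem_iff (pairwise_departureBlocks K 0 0 y) fun {c} => by
    rw [← List.mem_toFinset, ← List.mem_toFinset]
    exact Finset.ext_iff.1 h c

lemma card_departureSet (K : ℕ) (x : List (Option A)) :
    (departureSet K x).card = (departureBlocks K 0 0 x).length :=
  List.toFinset_card_of_nodup ((pairwise_departureBlocks K 0 0 x).imp ne_of_lt)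

lemma lastIdle_notMem (K N : ℕ) (x : List (Option A)) :
    lastIdle N (departureSet K x) ∉ departureSet K x := by
  refine Nat.findGreatest_spec (P := (· ∉ departureSet K x)) (m := 0) (Nat.zero_le N) fun h => ?_
  exact absurd (lt_of_mem_departureBlocks (List.mem_toFinset.1 h)).2 (lt_irrefl 0)

lemma card_filter_departureSet (K : ℕ) (x : List (Option A)) {c : ℕ} (hc : c ∉ departureSet K x) :
    ((departureSet K x).filter (c < ·)).card = (x.drop (c * (K + 1))).reduceOption.length := by
  rw [← length_filter_departureBlocks (t := 0) (b := 0) (fun h => hc (List.mem_toFinset.2 h))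
    (zero_add _) (fun h => Nat.pos_of_mul_pos_right h),
    ← List.toFinset_card_of_nodup (((pairwise_departureBlocks K 0 0 x).imp ne_of_lt).filter _)]
  congr 1
  ext d
  simp [departureSet]

lemma eq_Ioc_of_pred_mem {F : Finset ℕ} {c : ℕ} (hF : ∀ d ∈ F, c < d)
    (hpred : ∀ d ∈ F, c + 1 < d → d - 1 ∈ F) : F = Finset.Ioc c (c + F.card) := by
  have hIoc : ∀ d ∈ F, Finset.Ioc c d ⊆ F := by
    intro d
    induction d with
    | zero => simp
    | succ d ih =>
      intro hd e he
      rw [Finset.mem_Ioc] at he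
      rcases Nat.lt_or_ge d e with h | h
      · rwa [show e = d + 1 by omega]
      · exact ih (hpred _ hd (by omega)) (Finset.mem_Ioc.2 ⟨he.1, h⟩)
  refine Finset.eq_of_subset_of_card_le (fun d hd => ?_) (by simp)
  have := Finset.card_le_card (hIoc d hd)
  rw [Nat.card_Ioc] at this
  exact Finset.mem_Ioc.2 ⟨hF d hd, by omega⟩

/-- Behind its last idle block the server is busy in consecutive blocks. -/
lemma filter_departureSet_eq_Ioc {K n : ℕ} {x : List (Option A)} (hn : x.length = n) {c : ℕ}
    (hc : lastIdle (n / (K + 1)) (departureSet K x) = c) :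
    (departureSet K x).filter (c < ·) =
      Finset.Ioc c (c + ((departureSet K x).filter (c < ·)).card) := by
  refine eq_Ioc_of_pred_mem (fun d hd => (Finset.mem_filter.1 hd).2) fun d hd hcd => ?_
  rw [Finset.mem_filter] at hd ⊢
  refine ⟨?_, by omega⟩
  rcases Nat.lt_or_ge (n / (K + 1)) (d - 1) with h | h
  · rcases pred_mem_departureBlocks (List.mem_toFinset.1 hd.1)
      (by rw [hn, zero_add]; omega) with h1 | h1
    · exact List.mem_toFinset.2 h1
    · omega
  · by_contra hne
    exact Nat.findGreatest_is_greatest (P := (· ∉ departureSet K x)) (n := n / (K + 1))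
      (k := d - 1) (by rw [lastIdle] at hc; rw [hc]; omega) h hne

lemma eq_filter_lt_union_filter_gt {S : Finset ℕ} {c : ℕ} (hc : c ∉ S) :
    S = S.filter (· < c) ∪ S.filter (c < ·) := by
  rw [← Finset.filter_or]
  refine (Finset.filter_true_of_mem fun d hd => ?_).symm
  exact lt_or_gt_of_ne fun h => hc (h ▸ hd)

/-! ### The converse -/

open Classical in
/-- The codewords with given last idle block `c` and given number `m` of packets behind it: their
departure sets are determined by the part below `c`. -/
lemma IsZeroErrorCode.card_filter_le {K : ℕ} {φ : PMF (Fin (K + 1))}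
    (hφ : ∀ k, 0 < φ k) {V : A → PMF B} {C₀ : ℝ}
    (hC₀ : zeroErrorCapacity (memoryless V) = (C₀ : EReal)) {n : ℕ} {C : Finset (List (Option A))}
    (hC : IsZeroErrorCode (noisyQueue φ V) n C) (c m : ℕ) :
    ((C.filter fun x => lastIdle (n / (K + 1)) (departureSet K x) = c ∧
      ((departureSet K x).filter (c < ·)).card = m).card : ℝ) ≤
        ((2 : ℝ) ^ C₀ + 1) ^ c * ((2 : ℝ) ^ C₀) ^ m := by
  set T := C.filter fun x => lastIdle (n / (K + 1)) (departureSet K x) = c ∧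
      ((departureSet K x).filter (c < ·)).card = m with hTdef
  have hT : ∀ x ∈ T, departureSet K x = (departureSet K x).filter (· < c) ∪ Finset.Ioc c (c + m) ∧
      ((departureSet K x).filter (· < c)).card + m = (departureSet K x).card := by
    intro x hx
    obtain ⟨hxC, hc, hm⟩ := Finset.mem_filter.1 hx
    have hcS : c ∉ departureSet K x := hc ▸ lastIdle_notMem K _ x
    have h1 := eq_filter_lt_union_filter_gt hcS
    have h2 := filter_departureSet_eq_Ioc (hC.2.1 x hxC) hc
    rw [hm] at h2
    refine ⟨by rw [← h2]; exact h1, ?_⟩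
    conv_rhs => rw [h1]
    rw [Finset.card_union_of_disjoint, hm]
    rw [Finset.disjoint_filter]
    intro d _ h h'
    omega
  have hmaps : ∀ x ∈ T, (departureSet K x).filter (· < c) ∈ (Finset.range c).powerset := by
    intro x _
    rw [Finset.mem_powerset]
    intro d hd
    exact Finset.mem_range.2 (Finset.mem_filter.1 hd).2
  rw [Finset.card_eq_sum_card_fiberwise hmaps, Nat.cast_sum]
  calc _ ≤ ∑ S ∈ (Finset.range c).powerset, ((2 : ℝ) ^ C₀) ^ S.card * ((2 : ℝ) ^ C₀) ^ m := by
        refine Finset.sum_le_sum fun S _ => ?_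
        rcases (T.filter fun x => (departureSet K x).filter (· < c) = S).eq_empty_or_nonempty with
          h | ⟨y, hy⟩
        · rw [h, Finset.card_empty, Nat.cast_zero]
          positivity
        · rw [Finset.mem_filter] at hy
          rw [← pow_add, ← hy.2, (hT y hy.1).2, card_departureSet]
          refine hC.card_le_of_departureBlocks_eq hφ hC₀
            ((Finset.filter_subset _ _).trans (Finset.filter_subset _ _)) fun x hx => ?_
          rw [Finset.mem_filter] at hx
          refine departureBlocks_eq_of_departureSet_eq ?_
          exact (hT x hx.1).1.trans (by rw [hx.2]; exact (hT y hy.1).1.symm)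
    _ = _ := by
        rw [← Finset.sum_mul]
        congr 1
        simpa using Finset.sum_pow_mul_eq_add_pow ((2 : ℝ) ^ C₀) 1 (Finset.range c)

/-- A Kraft inequality, up to a polynomial factor, for zero-error codes and mean output lengths. -/
lemma IsZeroErrorCode.sum_rpow_neg_le {K : ℕ} {φ : PMF (Fin (K + 1))}
    (hφ : ∀ k, 0 < φ k) {V : A → PMF B} {C₀ R : ℝ}
    (hC₀ : zeroErrorCapacity (memoryless V) = (C₀ : EReal)) {n : ℕ} {C : Finset (List (Option A))}
    (hC : IsZeroErrorCode (noisyQueue φ V) n C) (hR : 0 ≤ R)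
    (h1 : (2 : ℝ) ^ C₀ + 1 ≤ (2 : ℝ) ^ (R * ((K : ℝ) + 1)))
    (h2 : C₀ ≤ R * (meanProcessingTime φ + 1)) :
    ∑ x ∈ C, (2 : ℝ) ^ (-(R * (meanLength (noisyQueue φ V) x).toReal)) ≤ ((n : ℝ) + 1) ^ 2 := by
  have hmaps : ∀ x ∈ C, (lastIdle (n / (K + 1)) (departureSet K x), ((departureSet K x).filter
      (lastIdle (n / (K + 1)) (departureSet K x) < ·)).card) ∈
        Finset.range (n + 1) ×ˢ Finset.range (n + 1) := by
    intro x hx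
    rw [Finset.mem_product, Finset.mem_range, Finset.mem_range, Nat.lt_succ_iff, Nat.lt_succ_iff]
    refine ⟨(Nat.findGreatest_le _).trans (Nat.div_le_self _ _), ?_⟩
    rw [card_filter_departureSet K x (lastIdle_notMem K _ x), ← hC.2.1 x hx]
    exact (List.reduceOption_length_le _).trans (List.length_drop.trans_le (Nat.sub_le _ _))
  rw [← Finset.sum_fiberwise_of_maps_to hmaps]
  calc _ ≤ ∑ _p ∈ Finset.range (n + 1) ×ˢ Finset.range (n + 1), (1 : ℝ) := by
        refine Finset.sum_le_sum ?_
        rintro ⟨c, m⟩ _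
        set W : ℝ := R * (((c * (K + 1) : ℕ) : ℝ) + m * (meanProcessingTime φ + 1)) with hW
        have hcard := hC.card_filter_le hφ hC₀ c m
        have hpow : ((2 : ℝ) ^ C₀ + 1) ^ c * ((2 : ℝ) ^ C₀) ^ m ≤ (2 : ℝ) ^ W := by
          calc _ ≤ ((2 : ℝ) ^ (R * ((K : ℝ) + 1))) ^ c *
                ((2 : ℝ) ^ (R * (meanProcessingTime φ + 1))) ^ m := by
                gcongr
                norm_num
            _ = _ := by
                rw [← Real.rpow_mul_natCast (by norm_num), ← Real.rpow_mul_natCast (by norm_num),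
                  ← Real.rpow_add (by norm_num), hW]
                push_cast
                congr 1
                ring
        have hterm : ∀ x ∈ C, lastIdle (n / (K + 1)) (departureSet K x) = c →
            ((departureSet K x).filter (c < ·)).card = m →
            (2 : ℝ) ^ (-(R * (meanLength (noisyQueue φ V) x).toReal)) ≤ (2 : ℝ) ^ (-W) := by
          intro x hx hc hm
          refine Real.rpow_le_rpow_of_exponent_le (by norm_num) (neg_le_neg ?_)
          refine mul_le_mul_of_nonneg_left ?_ hR
          have hcn : c * (K + 1) ≤ x.length := by
            rw [hC.2.1 x hx, ← Nat.le_div_iff_mul_le K.succ_pos, ← hc]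
            exact Nat.findGreatest_le _
          -- The slots up to the end of block `c` and the service of the later packets add up.
          rw [← hm, card_filter_departureSet K x (hc ▸ lastIdle_notMem K _ x)]
          exact le_meanLength_toReal φ V x hcn
        have hfil : (C.filter fun x => (lastIdle (n / (K + 1)) (departureSet K x),
            ((departureSet K x).filter (lastIdle (n / (K + 1)) (departureSet K x) < ·)).card) =
              (c, m)) = C.filter fun x => lastIdle (n / (K + 1)) (departureSet K x) = c ∧
                ((departureSet K x).filter (c < ·)).card = m := by
          refine Finset.filter_congr fun x _ => ?_
          rw [Prod.mk.injEq]
          refine and_congr_right fun h => ?_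
          rw [h]
        rw [hfil]
        calc _ ≤ ∑ _x ∈ C.filter fun x => lastIdle (n / (K + 1)) (departureSet K x) = c ∧
                ((departureSet K x).filter (c < ·)).card = m, (2 : ℝ) ^ (-W) :=
              Finset.sum_le_sum fun x hx => by
                obtain ⟨hx, hc, hm⟩ := Finset.mem_filter.1 hx
                exact hterm x hx hc hm
          _ ≤ (2 : ℝ) ^ W * (2 : ℝ) ^ (-W) := by
              rw [Finset.sum_const, nsmul_eq_mul]
              gcongr
              convert hcard.trans hpow
          _ = 1 := by rw [← Real.rpow_add (by norm_num), add_neg_cancel, Real.rpow_zero]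
    _ = _ := by
        simp only [Finset.sum_const, Finset.card_product, Finset.card_range, nsmul_eq_mul]
        push_cast
        ring

/-- Jensen's inequality turns the Kraft inequality into a bound on the size of a code. -/
lemma logb_card_le_of_sum_rpow_neg_le {ι : Type*} {C : Finset ι} (hC : C.Nonempty) {f : ι → ℝ}
    {R W : ℝ} (h : ∑ x ∈ C, (2 : ℝ) ^ (-(R * f x)) ≤ W) :
    Real.logb 2 C.card ≤ R * (1 / (C.card : ℝ) * ∑ x ∈ C, f x) + Real.logb 2 W := by
  have hcard : (0 : ℝ) < C.card := by exact_mod_cast hC.card_pos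
  have hconv : ConvexOn ℝ Set.univ fun u : ℝ => (2 : ℝ) ^ u := by
    simp only [Real.rpow_def_of_pos (show (0 : ℝ) < 2 by norm_num)]
    exact (convexOn_exp.comp_linearMap (LinearMap.mul ℝ ℝ (Real.log 2)))
  have hJ := hconv.map_sum_le (t := C) (w := fun _ => 1 / (C.card : ℝ))
    (p := fun x => -(R * f x)) (fun _ _ => by positivity)
    (by rw [Finset.sum_const, nsmul_eq_mul]; field_simp) (fun _ _ => Set.mem_univ _)
  simp only [smul_eq_mul] at hJ
  rw [← Finset.mul_sum, ← Finset.mul_sum, Finset.sum_neg_distrib, ← Finset.mul_sum] at hJ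
  have hW : 0 < W := lt_of_lt_of_le (Finset.sum_pos (fun _ _ => by positivity) hC) h
  have h1 : (2 : ℝ) ^ (1 / (C.card : ℝ) * -(R * ∑ x ∈ C, f x)) ≤ W / C.card := by
    refine hJ.trans ?_
    rw [one_div_mul_eq_div]
    gcongr
  rw [← Real.le_logb_iff_rpow_le (by norm_num) (by positivity),
    Real.logb_div hW.ne' hcard.ne'] at h1
  linarith

/-- The converse, for every `R` that is at least both terms of the maximum. -/
lemma zeroErrorCapacity_noisyQueue_le {K : ℕ} {φ : PMF (Fin (K + 1))}
    (hφ : ∀ k, 0 < φ k) {V : A → PMF B} {C₀ R : ℝ}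
    (hC₀ : zeroErrorCapacity (memoryless V) = (C₀ : EReal)) (hR : 0 ≤ R)
    (h1 : (2 : ℝ) ^ C₀ + 1 ≤ (2 : ℝ) ^ (R * ((K : ℝ) + 1)))
    (h2 : C₀ ≤ R * (meanProcessingTime φ + 1)) :
    zeroErrorCapacity (noisyQueue φ V) ≤ (R : EReal) := by
  have hlim : Filter.Tendsto (fun n : ℕ => R + 2 * Real.logb 2 ((n : ℝ) + 1) / (n : ℝ))
      Filter.atTop (nhds R) := by
    have hlog : Filter.Tendsto (fun n : ℕ => Real.log ((n : ℝ) + 1) / (n : ℝ)) Filter.atTop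
        (nhds 0) := by
      have h := Real.tendsto_pow_log_div_mul_add_atTop 1 (-1) 1 one_ne_zero
      have h' := h.comp (Filter.tendsto_atTop_add_const_right _ (1 : ℝ)
        tendsto_natCast_atTop_atTop)
      refine h'.congr fun n => ?_
      simp
    have h3 := (hlog.const_mul (2 / Real.log 2)).const_add R
    rw [mul_zero, add_zero] at h3
    refine h3.congr fun n => ?_
    rw [Real.logb]
    ring
  have hlim' : Filter.Tendsto
      (fun n : ℕ => ((R + 2 * Real.logb 2 ((n : ℝ) + 1) / (n : ℝ) : ℝ) : EReal))
      Filter.atTop (nhds (R : EReal)) :=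
    (continuous_coe_real_ereal.tendsto R).comp hlim
  rw [← hlim'.limsup_eq]
  refine Filter.limsup_le_limsup ?_
  filter_upwards [Filter.eventually_gt_atTop 0] with n hn
  refine iSup₂_le fun C hC => EReal.coe_le_coe ?_
  have hn' : (0 : ℝ) < n := by exact_mod_cast hn
  have hcard : (0 : ℝ) < C.card := by exact_mod_cast hC.1.card_pos
  have hlen : (n : ℝ) ≤ averageLength (noisyQueue φ V) C := by
    rw [averageLength_eq, one_div_mul_eq_div, le_div_iff₀ hcard, mul_comm, ← nsmul_eq_mul]
    refine Finset.card_nsmul_le_sum _ _ _ fun x hx => ?_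
    have h := le_meanLength_toReal φ V x le_rfl
    rw [List.drop_length, hC.2.1 x hx] at h
    simpa using h
  have hbound := logb_card_le_of_sum_rpow_neg_le hC.1 (hC.sum_rpow_neg_le hφ hC₀ hR h1 h2)
  rw [← averageLength_eq, Real.logb_pow] at hbound
  have hL : 0 < averageLength (noisyQueue φ V) C := hn'.trans_le hlen
  have hlog : 0 ≤ Real.logb 2 ((n : ℝ) + 1) := Real.logb_nonneg (by norm_num) (by linarith)
  calc codeRate (noisyQueue φ V) C
      ≤ 1 / averageLength (noisyQueue φ V) C * (R * averageLength (noisyQueue φ V) C +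
          2 * Real.logb 2 ((n : ℝ) + 1)) := by
        rw [codeRate]
        gcongr
        exact_mod_cast hbound
    _ = R + 2 * Real.logb 2 ((n : ℝ) + 1) / averageLength (noisyQueue φ V) C := by
        field_simp
    _ ≤ _ := by gcongr

end ZeroError

end

theorem mainTheorem6 (P K : ℕ) (hP : 1 ≤ P) {Y : Type*}
    (V : Fin P → PMF Y) (φ : PMF (Fin (K + 1))) (hφ : ∀ k, 0 < φ k)
    (C₀ : ℝ) (hC₀ : ZeroError.zeroErrorCapacity (ZeroError.memoryless V) = (C₀ : EReal)) :
    ZeroError.zeroErrorCapacity (ZeroError.noisyQueue φ V) =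
      ((max (Real.logb 2 ((2 : ℝ) ^ C₀ + 1) / ((K : ℝ) + 1))
        (C₀ / (ZeroError.meanProcessingTime φ + 1)) : ℝ) : EReal) := by
  have : Nonempty (Fin P) := ⟨⟨0, hP⟩⟩
  have hE := ZeroError.meanProcessingTime_nonneg φ
  have hK : (0 : ℝ) < (K : ℝ) + 1 := by positivity
  have hq : (0 : ℝ) < (2 : ℝ) ^ C₀ := by positivity
  refine le_antisymm ?_ ?_
  · refine ZeroError.zeroErrorCapacity_noisyQueue_le hφ hC₀ ?_ ?_ ?_
    · exact le_max_of_le_left (div_nonneg (Real.logb_nonneg (by norm_num) (by linarith)) hK.le)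
    · rw [← Real.logb_le_iff_le_rpow (by norm_num) (by positivity), ← div_le_iff₀ hK]
      exact le_max_left _ _
    · rw [← div_le_iff₀ (by positivity)]
      exact le_max_right _ _
  · rcases max_choice (Real.logb 2 ((2 : ℝ) ^ C₀ + 1) / ((K : ℝ) + 1))
      (C₀ / (ZeroError.meanProcessingTime φ + 1)) with h | h <;> rw [h]
    · exact ZeroError.logb_div_le_zeroErrorCapacity_noisyQueue φ hC₀
    · exact ZeroError.div_le_zeroErrorCapacity_noisyQueue φ hC₀
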